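/- Let $\mathcal E$ be a finite non-empty set of basic events, $\Omega=\{0,1\}^{\mathcal E}$ the set of atoms, $\Sigma=\mathcal P(\Omega)$ the algebra of events, and for a probability $\Pr$ on $\Omega$ give $\Omega^\infty$ the product probability, also written $\Pr$. Past-time temporal logic $\mathrm{TL}$ over $\mathcal E$ has the Boolean connectives (an event of $\Sigma$ is written as a Boolean combination of basic events), "previously" $\ominus$ and $\mathsf{Since}$, evaluated in the states of finite non-empty words over $\Omega$: $\ominus\varphi$ holds in a state that is not the initial one and whose predecessor satisfies $\varphi$, and $\varphi\,\mathsf{Since}\,\psi$ holds in $s$ iff $\psi$ holds in some $t\le s$ and $\varphi$ holds in all $u$ with $t<u\le s$; "once" is $\Diamond\varphi=(\mathit{true}\,\mathsf{Since}\,\varphi)$. A conditional $c=(\varphi|\psi)$ with $\varphi,\psi\in\mathrm{TL}$ takes on a word the value $1$, $0$ or $\bot$ according to whether $\varphi\wedge\psi$, $\neg\varphi\wedge\psi$ or $\neg\psi$ holds in its last state. It gives the stochastic process $c_1,c_2,\dots$ on $\Omega^\infty$, where $c_n(w)$ is the value of $c$ on the prefix of $w$ of length $n$. Its asymptotic probability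 is $\Pr(c)=\lim_n \Pr(c_n=1)/\Pr(c_n\ne\bot)$, provided that the denominators are non-zero for all large $n$ and the limit exists. Two conditionals $c,d$ are independent if for all $t\geq 1$ and $x,y\in\{0,1,\bot\}^t$ the events $\{(c_1,\dots,c_t)=x\}$ and $\{(d_1,\dots,d_t)=y\}$ are independent. Flat conditional expressions are built from simple conditionals $(a|b)$, $a,b\in\Sigma$, by $\wedge,\vee,\sim$. In the product space (PS) conditional event algebra, $(a|b)$ denotes $\bigcup_{j\ge0}(\Omega\setminus b)^j\times(a\cap b)\times\Omega\times\Omega\times\cdots\subseteq\Omega^\infty$, the connectives denote intersection, union and complement, and $\Pr_o(e)$ is the product probability of the set denoted by $e$. The first embedding sends $e$ to $F(e)=(e^F|\mathit{true})$, where $e^F\in\mathrm{TL}$ arises from $e$ by replacing each $(a|b)$ by $\Diamond(a\wedge b\wedge\neg\ominus\Diamond b)$. The sparse reverse interpretation sends $e$ to $R(e)=(e^R|\bigvee_i(b_i\vee\neg\Diamond b_i))$, where $(a_i|b_i)$ are the simple conditionals occurring in $e$ and $e^R$ arises from $e$ by replacing each $(a|b)$ by $\neg b\,\mathsf{Since}\,(a\wedge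 b)$. Then: 1. For every probability $\Pr$ on $\Omega$ and every flat expression $e$, the asymptotic probabilities of $F(e)$ and $R(e)$ exist and $\Pr(F(e))=\Pr(R(e))=\Pr_o(e)$. 2. Let $\Pr$ be a probability on $\Omega$, let $a\in\Sigma$ with $0<\Pr(a)<1$, and let $e_1=e_2=(\varnothing|a)$. The processes of $F(e_1)$ and $F(e_2)$ are constantly $0$, hence independent, while $R(e_1)$ and $R(e_2)$ are not independent. Consequently no set of equalities between (possibly partial) real functions of finitely many asymptotic probabilities of interpreted flat expressions holds exactly if $e_1,e_2$ have independent interpretations, simultaneously for the interpretation $F$ and for the interpretation $R$. In particular there are a probability on $\Omega$ and expressions $e_1,e_2$ such that $F(e_1),F(e_2)$ are independent and $R(e_1),R(e_2)$ are not. 3. Independence in the PS conditional event algebra cannot be characterized by equalities of asymptotic probabilities: there is no assignment of a set $S(e_1,e_2)$ of such equalities to the pairs of flat expressions (not depending on the probability on $\Omega$) such that, for both $I=F$ and $I=R$, for every probability on $\Omega$ and all $e_1,e_2$, the conditionals $I(e_1),I(e_2)$ are independent if and only if all equalities in $S(e_1,e_2)$ hold between the asymptotic probabilities $\Pr(I(e))$.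 (An equality whose sides are both undefined counts as holding.) -/

import Mathlib

open MeasureTheory Filter Topology

noncomputable section

namespace CondEvent

/-- The set `Ω` of atoms of the Boolean algebra freely generated by the basic events `E`:
an atom is a truth assignment to the basic events. It is also a state of a temporal model. -/
abbrev Atom (E : Type*) := E → Bool

/-- The Boolean algebra `Σ` of events, i.e. the power set of `Ω`. -/
abbrev Event (E : Type*) := Set (Atom E)

/-- The three truth values `0`, `1` and `⊥` (undefined). -/
inductive Three
  | zero
  | one
  | undef

/-! ### Temporal logic of linear discrete past time -/

/-- Formulas of past-time temporal logic over the basic events `E`. -/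
inductive TL (E : Type*)
  | tru : TL E
  | basic : E → TL E
  | neg : TL E → TL E
  | disj : TL E → TL E → TL E
  | prev : TL E → TL E
  | since : TL E → TL E → TL E

namespace TL

variable {E : Type*}

/-- Conjunction. -/
def conj (φ ψ : TL E) : TL E := neg (disj (neg φ) (neg ψ))

/-- `once φ`: the formula `true Since φ`. -/
def once (φ : TL E) : TL E := since tru φ

/-- Satisfaction in the state `s` of the finite model `M = s₀, …, sₙ`. -/
def Sat {n : ℕ} (M : Fin (n + 1) → Atom E) : TL E → Fin (n + 1) → Prop
  | tru, _ => True
  | basic a, s => M s a = true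
  | neg φ, s => ¬ Sat M φ s
  | disj φ ψ, s => Sat M φ s ∨ Sat M ψ s
  | prev φ, s => ∃ t : Fin (n + 1), (t : ℕ) + 1 = s ∧ Sat M φ t
  | since φ ψ, s => ∃ t : Fin (n + 1), t ≤ s ∧ Sat M ψ t ∧
      ∀ u : Fin (n + 1), t < u → u ≤ s → Sat M φ u

/-- Finite disjunctions. -/
def disjList (l : List (TL E)) : TL E := l.foldr disj (neg tru)

/-- Finite conjunctions. -/
def conjList (l : List (TL E)) : TL E := l.foldr conj tru

/-- The conjunction of literals describing an atom. -/
def ofAtom [Fintype E] (ω : Atom E) : TL E :=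
  conjList ((Finset.univ : Finset E).toList.map
    fun a => if ω a = true then basic a else neg (basic a))

/-- An event written as a propositional formula (in full disjunctive normal form). -/
def ofEvent [Fintype E] (x : Event E) : TL E :=
  disjList ((Set.toFinite x).toFinset.toList.map ofAtom)

theorem sat_disjList {n : ℕ} (M : Fin (n + 1) → Atom E) (s : Fin (n + 1)) (l : List (TL E)) :
    Sat M (disjList l) s ↔ ∃ φ ∈ l, Sat M φ s := by
  induction l with
  | nil => simp [disjList, Sat]
  | cons φ l ih =>
    have h : disjList (φ :: l) = disj φ (disjList l) := rfl
    simp [h, Sat, ih]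

theorem sat_conjList {n : ℕ} (M : Fin (n + 1) → Atom E) (s : Fin (n + 1)) (l : List (TL E)) :
    Sat M (conjList l) s ↔ ∀ φ ∈ l, Sat M φ s := by
  induction l with
  | nil => simp [conjList, Sat]
  | cons φ l ih =>
    have h : conjList (φ :: l) = conj φ (conjList l) := rfl
    simp [h, conj, Sat, ih]

theorem sat_ofAtom [Fintype E] {n : ℕ} (M : Fin (n + 1) → Atom E) (s : Fin (n + 1))
    (ω : Atom E) : Sat M (ofAtom ω) s ↔ M s = ω := by
  simp only [ofAtom, sat_conjList, List.mem_map, Finset.mem_toList, Finset.mem_univ, true_and,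
    forall_exists_index, forall_apply_eq_imp_iff]
  constructor
  · intro h
    funext a
    have := h a
    cases hω : ω a <;> simp_all [Sat]
  · rintro rfl a
    split <;> simp_all [Sat]

/-- The propositional formula of an event holds exactly in the states that lie in the event. -/
theorem sat_ofEvent [Fintype E] {n : ℕ} (M : Fin (n + 1) → Atom E) (s : Fin (n + 1))
    (x : Event E) : Sat M (ofEvent x) s ↔ M s ∈ x := by
  simp [ofEvent, sat_disjList, sat_ofAtom]

end TL

/-! ### Conditional objects and conditional events -/

/-- A formula `(φ|ψ)` of the three-valued logic `(TL|TL)`. -/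
structure CondFormula (E : Type*) where
  concl : TL E
  given : TL E

/-- Nonempty finite words over `Ω`; the word `⟨n, M⟩` has length `n + 1`. -/
abbrev Word (E : Type*) := Σ n : ℕ, (Fin (n + 1) → Atom E)

open Classical in
/-- The conditional object of `(φ|ψ)`: its truth value in the last state of a word. -/
def CondFormula.object {E : Type*} (c : CondFormula E) (w : Word E) : Three :=
  if c.given.Sat w.2 (Fin.last w.1) then
    if c.concl.Sat w.2 (Fin.last w.1) then Three.one else Three.zero
  else Three.undef

/-- The conditional event of a conditional object as a stochastic process on `Ω^∞`;
`process c n` is the value on the prefix of length `n + 1`, so the times `1, 2, 3, …` are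
numbered `0, 1, 2, …`. -/
def process {E : Type*} (c : Word E → Three) (n : ℕ) (w : ℕ → Atom E) : Three :=
  c ⟨n, fun i => w i⟩

/-- The product probability on `Ω^∞`. -/
def prodProb {E : Type*} [Fintype E] (μ : Measure (Atom E)) [IsProbabilityMeasure μ] :
    Measure (ℕ → Atom E) :=
  Measure.infinitePi fun _ : ℕ => μ

section Prob

variable {E : Type*} [Fintype E] (μ : Measure (Atom E)) [IsProbabilityMeasure μ]

/-- `r` is the asymptotic probability of `c`: for all sufficiently large `n` the probability
that `c` is defined at time `n` is nonzero, and the quotients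
`Pr(cₙ = 1) / Pr(cₙ = 0 or 1)` tend to `r`. -/
def HasAsympProb (c : Word E → Three) (r : ℝ) : Prop :=
  (∀ᶠ n in atTop, (prodProb μ).real {w | process c n w ≠ Three.undef} ≠ 0) ∧
  Tendsto (fun n => (prodProb μ).real {w | process c n w = Three.one} /
    (prodProb μ).real {w | process c n w ≠ Three.undef}) atTop (𝓝 r)

open Classical in
/-- The asymptotic probability of `c`, with value `none` when it is undefined. -/
def asympProb (c : Word E → Three) : Option ℝ :=
  if h : ∃ r, HasAsympProb μ c r then some h.choose else none

/-- Independence of the conditional events of `c` and `d` as stochastic processes: the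
histories up to any time are independent. -/
def Indep (c d : Word E → Three) : Prop :=
  ∀ (t : ℕ) (x y : Fin t → Three),
    prodProb μ {w | (∀ i : Fin t, process c i w = x i) ∧ ∀ i : Fin t, process d i w = y i} =
      prodProb μ {w | ∀ i : Fin t, process c i w = x i} *
        prodProb μ {w | ∀ i : Fin t, process d i w = y i}

end Prob

/-! ### Flat conditional expressions and the product space algebra -/

/-- Flat conditional expressions. -/
inductive FlatExpr (E : Type*)
  | simple : Event E → Event E → FlatExpr E
  | conj : FlatExpr E → FlatExpr E → FlatExpr E
  | disj : FlatExpr E → FlatExpr E → FlatExpr E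
  | neg : FlatExpr E → FlatExpr E

namespace FlatExpr

variable {E : Type*}

/-- The element of the product space algebra denoted by an expression. For `(a|b)` it is the
union over `j` of the cylinders `(Ω \ b)^j × (b ∩ a) × Ω × Ω × ⋯`. -/
def ps : FlatExpr E → Set (ℕ → Atom E)
  | simple a b => ⋃ j : ℕ, {w | (∀ i < j, w i ∈ bᶜ) ∧ w j ∈ b ∩ a}
  | conj e e' => ps e ∩ ps e'
  | disj e e' => ps e ∪ ps e'
  | neg e => (ps e)ᶜ

/-- The product space probability of an expression. -/
def psProb [Fintype E] (μ : Measure (Atom E)) [IsProbabilityMeasure μ] (e : FlatExpr E) : ℝ :=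
  (prodProb μ).real e.ps

variable [Fintype E]

/-- The temporal formula of the first embedding; `(a|b)` becomes
`once (a ∧ b ∧ ¬ previously (once b))`. -/
def firstTL : FlatExpr E → TL E
  | simple a b => TL.once (TL.conj (TL.conj (TL.ofEvent a) (TL.ofEvent b))
      (TL.neg (TL.prev (TL.once (TL.ofEvent b)))))
  | conj e e' => TL.conj (firstTL e) (firstTL e')
  | disj e e' => TL.disj (firstTL e) (firstTL e')
  | neg e => TL.neg (firstTL e)

/-- The first embedding of the product space algebra into conditional objects. -/
def first (e : FlatExpr E) : Word E → Three :=
  CondFormula.object ⟨firstTL e, TL.tru⟩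

/-- The temporal formula of the reverse embedding; `(a|b)` becomes `¬b Since (a ∧ b)`. -/
def revTL : FlatExpr E → TL E
  | simple a b => TL.since (TL.neg (TL.ofEvent b)) (TL.conj (TL.ofEvent a) (TL.ofEvent b))
  | conj e e' => TL.conj (revTL e) (revTL e')
  | disj e e' => TL.disj (revTL e) (revTL e')
  | neg e => TL.neg (revTL e)

/-- The disjunction of `b ∨ ¬ once b` over all simple conditionals `(a|b)` occurring in the
expression. -/
def sparseGiven : FlatExpr E → TL E
  | simple _ b => TL.disj (TL.ofEvent b) (TL.neg (TL.once (TL.ofEvent b)))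
  | conj e e' => TL.disj (sparseGiven e) (sparseGiven e')
  | disj e e' => TL.disj (sparseGiven e) (sparseGiven e')
  | neg e => sparseGiven e

/-- The sparse reverse interpretation of the product space algebra in conditional objects. -/
def sparse (e : FlatExpr E) : Word E → Three :=
  CondFormula.object ⟨revTL e, sparseGiven e⟩

end FlatExpr

/-! ### Equalities of asymptotic probabilities -/

/-- One side of an equality of probabilities: a (possibly partial) real function, for instance
a polynomial or a quotient, applied to the probabilities of finitely many flat expressions. -/
structure ProbTerm (E : Type*) where
  arity : ℕ
  arg : Fin arity → FlatExpr E
  fn : (Fin arity → ℝ) → Option ℝ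

open Classical in
/-- The value of a term under a (partial) assignment of probabilities to the expressions;
it is undefined if one of the probabilities in it is. -/
def ProbTerm.value {E : Type*} (P : FlatExpr E → Option ℝ) (τ : ProbTerm E) : Option ℝ :=
  if h : ∀ i, (P (τ.arg i)).isSome = true then τ.fn fun i => (P (τ.arg i)).get (h i) else none

/-- All equalities of the set `S` hold under the assignment `P`; an equality with both sides
undefined holds. -/
def EqualitiesHold {E : Type*} (P : FlatExpr E → Option ℝ) (S : Set (ProbTerm E × ProbTerm E)) :
    Prop :=
  ∀ q ∈ S, q.1.value P = q.2.value P

/-- Under the interpretation `I` of expressions as conditional objects, the equalities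
`S e₁ e₂` (which do not depend on the probability space) hold between asymptotic probabilities
exactly when `e₁` and `e₂` are interpreted by independent processes. -/
def CharacterizesIndep {E : Type*} [Fintype E] (I : FlatExpr E → Word E → Three)
    (S : FlatExpr E → FlatExpr E → Set (ProbTerm E × ProbTerm E)) : Prop :=
  ∀ (μ : Measure (Atom E)) [IsProbabilityMeasure μ] (e₁ e₂ : FlatExpr E),
    Indep μ (I e₁) (I e₂) ↔ EqualitiesHold (fun e => asympProb μ (I e)) (S e₁ e₂)

end CondEvent

end

open CondEvent

namespace CondEvent

/-! ### The product probability -/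

section ProductProbability

variable {E : Type*} [Fintype E] (μ : Measure (Atom E)) [IsProbabilityMeasure μ]

/-! Both interpretations have the same asymptotic probabilities but different independence
relations, so no system of equalities can serve both. At each time the first embedding is a
truncation `psUpTo` of the product space event; the truncations converge pointwise, hence in
probability. For the sparse interpretation, reversing the prefix, which preserves the product
measure, turns `Since` into the same truncation, observed on `domUpTo`. Its quotients tend to
Pr(`ps` ∩ `dom`) / Pr(`dom`), so it remains to see that `ps` is independent of `dom`. Almost surely
`dom` is everything or says that the first letter meets some condition (`ae_mem_dom_iff`). A first
letter meeting no condition can be dropped without affecting `ps` (`mem_ps_iff_tail`), and the tail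
is a copy of the whole sequence independent of the head; this gives the independence. The processes
separate on (∅|a): the first embedding is constantly 0, while the sparse one is undefined at random
times and so is not independent of itself. -/

instance isProbabilityMeasure_prodProb : IsProbabilityMeasure (prodProb μ) := by
  unfold prodProb; infer_instance

/-- The sequence obtained by reversing the order of the first `n + 1` letters. -/
def revPrefix {α : Type*} (n : ℕ) (w : ℕ → α) (i : ℕ) : α := w (if i ≤ n then n - i else i)

theorem revPrefix_of_le {α : Type*} {n i : ℕ} (w : ℕ → α) (h : i ≤ n) :
    revPrefix n w i = w (n - i) := by
  simp [revPrefix, h]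

/-- The reversal merely reindexes i.i.d. coordinates along an injective map of the indices. -/
theorem measurePreserving_revPrefix (n : ℕ) :
    MeasurePreserving (revPrefix n) (prodProb μ) (prodProb μ) := by
  refine ⟨by unfold revPrefix; fun_prop, ?_⟩
  have hinj : Function.Injective fun i : ℕ => if i ≤ n then n - i else i := by
    intro i j hij
    dsimp only at hij
    split_ifs at hij <;> omega
  exact Measure.map_infinitePi_infinitePi_of_inj (P := fun _ : ℕ => μ) hinj

/-- The word with first letter `p.1` and tail `p.2`. -/
def consWord {α : Type*} (p : α × (ℕ → α)) (i : ℕ) : α := Nat.casesOn i p.1 p.2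

theorem measurable_consWord {α : Type*} [MeasurableSpace α] :
    Measurable (consWord : α × (ℕ → α) → ℕ → α) := by
  refine measurable_pi_lambda _ fun i => ?_
  cases i with
  | zero => exact measurable_fst
  | succ i => exact (measurable_pi_apply i).comp measurable_snd

theorem map_consWord :
    (μ.prod (prodProb μ)).map consWord = prodProb μ := by
  classical
  refine Measure.eq_infinitePi _ fun s t ht => ?_
  obtain ⟨N, hN⟩ : ∃ N, s ⊆ Finset.range (N + 1) :=
    ⟨s.sup id, fun i hi => Finset.mem_range.2 (Nat.lt_succ_of_le (Finset.le_sup (f := id) hi))⟩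
  -- Padding with `Set.univ` replaces the index set by an initial segment, from which the factor at
  -- 0 splits off.
  let t' : ℕ → Set (Atom E) := fun i => if i ∈ s then t i else Set.univ
  have hpre : consWord ⁻¹' Set.pi (s : Set ℕ) t =
      t' 0 ×ˢ Set.pi (Finset.range N : Set ℕ) (fun i => t' (i + 1)) := by
    ext ⟨x, w⟩
    simp only [Set.mem_preimage, Set.mem_pi, Finset.mem_coe, Set.mem_prod, Finset.mem_range, t']
    constructor
    · intro h
      refine ⟨?_, fun i _ => ?_⟩
      · split_ifs with h0
        · exact h 0 h0
        · trivial
      · split_ifs with h1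
        · exact h _ h1
        · trivial
    · rintro ⟨h0, h1⟩ i hi
      cases i with
      | zero => simpa [hi, consWord] using h0
      | succ i =>
        have := h1 i (by have := Finset.mem_range.1 (hN hi); omega)
        simpa [hi, consWord] using this
  rw [Measure.map_apply measurable_consWord
      (MeasurableSet.pi s.countable_toSet fun i _ => ht i), hpre, Measure.prod_prod, prodProb,
    Measure.infinitePi_pi _ (fun i _ => Set.Finite.measurableSet (Set.toFinite _)), mul_comm,
    ← Finset.prod_range_succ' (fun i => μ (t' i)), ← Finset.prod_subset hN]
  · exact Finset.prod_congr rfl fun i hi => by simp [t', hi]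
  · intro i _ hi
    simp [t', hi]

/-- The first letter is independent of the tail, and the tail has the same distribution as the
whole sequence. -/
theorem prodProb_head_inter_tail (x : Event E) {A : Set (ℕ → Atom E)} (hA : MeasurableSet A) :
    prodProb μ ({w | w 0 ∈ x} ∩ {w | (fun i => w (i + 1)) ∈ A}) = μ x * prodProb μ A := by
  have hx : MeasurableSet x := (Set.toFinite x).measurableSet
  have hm : MeasurableSet ({w : ℕ → Atom E | w 0 ∈ x} ∩ {w | (fun i => w (i + 1)) ∈ A}) := by
    refine (measurable_pi_apply 0 hx).inter ?_
    exact (show Measurable fun (w : ℕ → Atom E) (i : ℕ) => w (i + 1) by fun_prop) hA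
  rw [← map_consWord, Measure.map_apply measurable_consWord hm, map_consWord,
    ← Measure.prod_prod]
  rfl

theorem measurableSet_letter (x : Event E) (i : ℕ) :
    MeasurableSet {w : ℕ → Atom E | w i ∈ x} :=
  measurable_pi_apply i (Set.toFinite x).measurableSet

theorem prodProb_letter (x : Event E) (i : ℕ) : prodProb μ {w | w i ∈ x} = μ x :=
  (measurePreserving_eval_infinitePi (fun _ : ℕ => μ) i).measure_preimage
    (Set.toFinite x).measurableSet.nullMeasurableSet

/-- An event of positive probability occurs almost surely. -/
theorem ae_exists_mem {x : Event E} (hx : μ x ≠ 0) : ∀ᵐ w ∂prodProb μ, ∃ i, w i ∈ x := by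
  have hm : MeasurableSet {w : ℕ → Atom E | ∀ i, w i ∈ xᶜ} := by
    rw [Set.ofPred_forall]
    exact MeasurableSet.iInter fun i => measurableSet_letter _ i
  have h := prodProb_head_inter_tail μ xᶜ hm
  -- Avoiding `x` forever means avoiding it now and in the tail, so its probability p satisfies p =
  -- μ(xᶜ) p; p ≠ 0 would force μ(xᶜ) = 1.
  have heq : ({w : ℕ → Atom E | w 0 ∈ xᶜ} ∩
      {w | (fun i => w (i + 1)) ∈ {w : ℕ → Atom E | ∀ i, w i ∈ xᶜ}}) =
      {w | ∀ i, w i ∈ xᶜ} := by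
    ext w
    constructor
    · rintro ⟨h0, h1⟩ i
      cases i with
      | zero => exact h0
      | succ i => exact h1 i
    · exact fun h => ⟨h 0, fun i => h (i + 1)⟩
  rw [heq] at h
  rw [ae_iff]
  simp only [not_exists]
  change prodProb μ {w | ∀ i, w i ∈ xᶜ} = 0
  by_contra h0
  have h1 : μ xᶜ = 1 := by
    have := (ENNReal.mul_left_inj h0 (measure_ne_top _ _)).1 (h.symm.trans (one_mul _).symm)
    exact this
  exact hx ((prob_compl_eq_one_iff (Set.toFinite x).measurableSet).1 h1)

theorem ae_forall_notMem {x : Event E} (hx : μ x = 0) : ∀ᵐ w ∂prodProb μ, ∀ i, w i ∉ x := by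
  refine ae_all_iff.2 fun i => ?_
  rw [ae_iff]
  simpa [hx] using prodProb_letter μ x i

end ProductProbability

/-! ### Truncated and reversed semantics of flat expressions -/

namespace FlatExpr

variable {E : Type*}

/-- The approximation of `ps` that depends on the first `n + 1` letters only. -/
def psUpTo (n : ℕ) : FlatExpr E → Set (ℕ → Atom E)
  | simple a b => {w | ∃ j ≤ n, (∀ i < j, w i ∉ b) ∧ w j ∈ b ∩ a}
  | conj e e' => psUpTo n e ∩ psUpTo n e'
  | disj e e' => psUpTo n e ∪ psUpTo n e'
  | neg e => (psUpTo n e)ᶜ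

/-- The time reversal of the domain of definition of the sparse interpretation at time `n`. -/
def domUpTo (n : ℕ) : FlatExpr E → Set (ℕ → Atom E)
  | simple _ b => {w | w 0 ∈ b ∨ ∀ i ≤ n, w i ∉ b}
  | conj e e' => domUpTo n e ∪ domUpTo n e'
  | disj e e' => domUpTo n e ∪ domUpTo n e'
  | neg e => domUpTo n e

/-- The limit of the sets `domUpTo n`. -/
def dom : FlatExpr E → Set (ℕ → Atom E)
  | simple _ b => {w | w 0 ∈ b ∨ ∀ i, w i ∉ b}
  | conj e e' => dom e ∪ dom e'
  | disj e e' => dom e ∪ dom e'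
  | neg e => dom e

/-- The union of the conditions `b` of the simple conditionals `(a|b)` in an expression. -/
def cond : FlatExpr E → Event E
  | simple _ b => b
  | conj e e' => cond e ∪ cond e'
  | disj e e' => cond e ∪ cond e'
  | neg e => cond e

/-- For each fixed `w` a simple conditional is settled by a finite witness if true and never gets
one if false. Convergence is only pointwise, which suffices and passes through negation, where
monotonicity in `n` would be lost. -/
theorem eventually_mem_psUpTo_iff (e : FlatExpr E) (w : ℕ → Atom E) :
    ∀ᶠ n in atTop, w ∈ psUpTo n e ↔ w ∈ ps e := by
  induction e with
  | simple a b =>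
    by_cases h : w ∈ ps (simple a b)
    · obtain ⟨j, hj, hj'⟩ := Set.mem_iUnion.1 h
      filter_upwards [eventually_ge_atTop j] with n hn
      exact iff_of_true ⟨j, hn, hj, hj'⟩ h
    · refine Eventually.of_forall fun n => iff_of_false ?_ h
      rintro ⟨j, -, hj, hj'⟩
      exact h (Set.mem_iUnion.2 ⟨j, hj, hj'⟩)
  | conj e e' ih ih' => filter_upwards [ih, ih'] with n h h' using and_congr h h'
  | disj e e' ih ih' => filter_upwards [ih, ih'] with n h h' using or_congr h h'
  | neg e ih => filter_upwards [ih] with n h using not_congr h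

theorem eventually_mem_domUpTo_iff (e : FlatExpr E) (w : ℕ → Atom E) :
    ∀ᶠ n in atTop, w ∈ domUpTo n e ↔ w ∈ dom e := by
  induction e with
  | simple a b =>
    by_cases h : ∃ i, w i ∈ b
    · obtain ⟨j, hj⟩ := h
      filter_upwards [eventually_ge_atTop j] with n hn
      exact or_congr Iff.rfl (iff_of_false (fun h => h j hn hj) (fun h => h j hj))
    · push Not at h
      exact Eventually.of_forall fun n => or_congr Iff.rfl (iff_of_true (fun i _ => h i) h)
  | conj e e' ih ih' => filter_upwards [ih, ih'] with n h h' using or_congr h h'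
  | disj e e' ih ih' => filter_upwards [ih, ih'] with n h h' using or_congr h h'
  | neg e ih => exact ih

/-- A first letter at which no condition is met is irrelevant. -/
theorem mem_ps_iff_tail (e : FlatExpr E) {w : ℕ → Atom E} (hw : w 0 ∉ cond e) :
    w ∈ ps e ↔ (fun i => w (i + 1)) ∈ ps e := by
  induction e with
  | simple a b =>
    simp only [ps, Set.mem_iUnion, Set.mem_ofPred_eq]
    constructor
    · rintro ⟨j, hj, hj'⟩
      cases j with
      | zero => exact absurd hj'.1 hw
      | succ j => exact ⟨j, fun i hi => hj (i + 1) (by omega), hj'⟩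
    · rintro ⟨j, hj, hj'⟩
      refine ⟨j + 1, fun i hi => ?_, hj'⟩
      cases i with
      | zero => exact hw
      | succ i => exact hj i (by omega)
  | conj e e' ih ih' =>
    exact and_congr (ih fun h => hw (Or.inl h)) (ih' fun h => hw (Or.inr h))
  | disj e e' ih ih' =>
    exact or_congr (ih fun h => hw (Or.inl h)) (ih' fun h => hw (Or.inr h))
  | neg e ih => exact not_congr (ih hw)

variable [Fintype E]

theorem measurableSet_psUpTo (n : ℕ) (e : FlatExpr E) : MeasurableSet (psUpTo n e) := by
  induction e with
  | simple a b =>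
    have : psUpTo n (simple a b) =
        ⋃ j ∈ Set.Iic n, (⋂ i ∈ Set.Iio j, {w | w i ∈ bᶜ}) ∩ {w | w j ∈ b ∩ a} := by
      ext w; simp [psUpTo, and_left_comm]
    rw [this]
    exact MeasurableSet.biUnion (Set.to_countable _) fun j _ =>
      (MeasurableSet.biInter (Set.to_countable _) fun i _ => measurableSet_letter _ i).inter
        (measurableSet_letter _ j)
  | conj e e' ih ih' => exact ih.inter ih'
  | disj e e' ih ih' => exact ih.union ih'
  | neg e ih => exact ih.compl

theorem measurableSet_domUpTo (n : ℕ) (e : FlatExpr E) : MeasurableSet (domUpTo n e) := by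
  induction e with
  | simple a b =>
    have : domUpTo n (simple a b) = {w | w 0 ∈ b} ∪ ⋂ i ∈ Set.Iic n, {w | w i ∈ bᶜ} := by
      ext w; simp [domUpTo]
    rw [this]
    exact (measurableSet_letter _ 0).union
      (MeasurableSet.biInter (Set.to_countable _) fun i _ => measurableSet_letter _ i)
  | conj e e' ih ih' => exact ih.union ih'
  | disj e e' ih ih' => exact ih.union ih'
  | neg e ih => exact ih

theorem measurableSet_ps (e : FlatExpr E) : MeasurableSet (ps e) :=
  measurableSet_of_tendsto_indicator atTop (measurableSet_psUpTo · e)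
    (eventually_mem_psUpTo_iff e)

section Probability

variable (μ : Measure (Atom E)) [IsProbabilityMeasure μ]

/-- If a condition `b` is null, it almost surely never occurs and `dom` is full; otherwise `b`
almost surely occurs, leaving only the test of the first letter. In unions a full set absorbs. The
clause `μ (cond e) ≠ 0` keeps the limiting denominator positive. -/
theorem ae_mem_dom_iff (e : FlatExpr E) :
    (μ (cond e) ≠ 0 ∧ ∀ᵐ w ∂prodProb μ, w ∈ dom e ↔ w 0 ∈ cond e) ∨
      ∀ᵐ w ∂prodProb μ, w ∈ dom e := by
  have union : ∀ e e' : FlatExpr E,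
      ((μ (cond e) ≠ 0 ∧ ∀ᵐ w ∂prodProb μ, w ∈ dom e ↔ w 0 ∈ cond e) ∨
        ∀ᵐ w ∂prodProb μ, w ∈ dom e) →
      ((μ (cond e') ≠ 0 ∧ ∀ᵐ w ∂prodProb μ, w ∈ dom e' ↔ w 0 ∈ cond e') ∨
        ∀ᵐ w ∂prodProb μ, w ∈ dom e') →
      ((μ (cond e ∪ cond e') ≠ 0 ∧
          ∀ᵐ w ∂prodProb μ, w ∈ dom e ∪ dom e' ↔ w 0 ∈ cond e ∪ cond e') ∨
        ∀ᵐ w ∂prodProb μ, w ∈ dom e ∪ dom e') := by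
    rintro e e' (⟨h0, h⟩ | h) (⟨-, h'⟩ | h')
    · refine Or.inl ⟨fun h1 => h0 (measure_mono_null Set.subset_union_left h1), ?_⟩
      filter_upwards [h, h'] with w hw hw' using or_congr hw hw'
    · exact Or.inr (h'.mono fun w hw => Or.inr hw)
    · exact Or.inr (h.mono fun w hw => Or.inl hw)
    · exact Or.inr (h.mono fun w hw => Or.inl hw)
  induction e with
  | simple a b =>
    by_cases hb : μ b = 0
    · exact Or.inr ((ae_forall_notMem μ hb).mono fun w hw => Or.inr hw)
    · refine Or.inl ⟨hb, (ae_exists_mem μ hb).mono fun w hw => or_iff_left ?_⟩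
      exact fun h => hw.elim h
  | conj e e' ih ih' => exact union e e' ih ih'
  | disj e e' ih ih' => exact union e e' ih ih'
  | neg e ih => exact ih

/-- Off `cond e` the event `ps e` depends on the tail alone, so the complementary part has
probability (1 - μ(`cond e`)) Pr(`ps e`); subtract. -/
theorem prodProb_ps_inter_head_cond (e : FlatExpr E) :
    (prodProb μ).real (ps e ∩ {w | w 0 ∈ cond e}) =
      (prodProb μ).real (ps e) * μ.real (cond e) := by
  have hdiff : ps e \ {w | w 0 ∈ cond e} =
      {w | w 0 ∈ (cond e)ᶜ} ∩ {w | (fun i => w (i + 1)) ∈ ps e} := by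
    ext w
    constructor
    · rintro ⟨h, h'⟩
      exact ⟨h', (mem_ps_iff_tail e h').1 h⟩
    · rintro ⟨h, h'⟩
      exact ⟨(mem_ps_iff_tail e h).2 h', h⟩
  have hadd := measureReal_inter_add_sdiff (μ := prodProb μ) (s := ps e)
    (measurableSet_letter (cond e) 0)
  have htail : (prodProb μ).real (ps e \ {w | w 0 ∈ cond e}) =
      (1 - μ.real (cond e)) * (prodProb μ).real (ps e) := by
    rw [hdiff, measureReal_def, prodProb_head_inter_tail μ _ (measurableSet_ps e),
      ENNReal.toReal_mul, ← measureReal_def, ← measureReal_def,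
      probReal_compl_eq_one_sub (Set.toFinite _).measurableSet]
  rw [htail] at hadd
  linarith

theorem prodProb_dom_ne_zero (e : FlatExpr E) : (prodProb μ).real (dom e) ≠ 0 := by
  rcases ae_mem_dom_iff μ e with ⟨h0, h⟩ | h
  · have : dom e =ᵐ[prodProb μ] {w | w 0 ∈ cond e} := eventuallyEq_set.2 h
    rw [measureReal_congr this, measureReal_def, prodProb_letter]
    exact ENNReal.toReal_ne_zero.2 ⟨h0, measure_ne_top _ _⟩
  · have : dom e =ᵐ[prodProb μ] Set.univ := eventuallyEq_univ.2 h
    rw [measureReal_congr this]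
    simp

/-- The product space event of an expression is independent of `dom`. -/
theorem prodProb_ps_inter_dom (e : FlatExpr E) :
    (prodProb μ).real (ps e ∩ dom e) = (prodProb μ).real (ps e) * (prodProb μ).real (dom e) := by
  rcases ae_mem_dom_iff μ e with ⟨-, h⟩ | h
  · have : dom e =ᵐ[prodProb μ] {w | w 0 ∈ cond e} := eventuallyEq_set.2 h
    rw [measureReal_congr this, measureReal_congr ((ae_eq_refl (ps e)).inter this),
      prodProb_ps_inter_head_cond, measureReal_def (prodProb μ) {w | w 0 ∈ cond e},
      prodProb_letter, measureReal_def μ]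
  · have : dom e =ᵐ[prodProb μ] Set.univ := eventuallyEq_univ.2 h
    rw [measureReal_congr this, measureReal_congr ((ae_eq_refl (ps e)).inter this)]
    simp

theorem tendsto_prodProb {A : ℕ → Set (ℕ → Atom E)} {B : Set (ℕ → Atom E)}
    (hA : ∀ n, MeasurableSet (A n)) (h : ∀ w, ∀ᶠ n in atTop, w ∈ A n ↔ w ∈ B) :
    Tendsto (fun n => (prodProb μ).real (A n)) atTop (𝓝 ((prodProb μ).real B)) :=
  (ENNReal.tendsto_toReal (measure_ne_top _ _)).comp
    (tendsto_measure_of_tendsto_indicator_of_isFiniteMeasure atTop _ hA h)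

end Probability

/-! ### The two interpretations in terms of the truncated semantics -/

/-- The conjunct with `prev` excludes an earlier `b`, so `once` can only be witnessed at the first
occurrence of `b`. -/
theorem sat_firstTL (e : FlatExpr E) (n : ℕ) (w : ℕ → Atom E) :
    (firstTL e).Sat (fun i : Fin (n + 1) => w i) (Fin.last n) ↔ w ∈ psUpTo n e := by
  induction e with
  | simple a b =>
    simp only [firstTL, TL.once, TL.conj, TL.Sat, TL.sat_ofEvent, psUpTo, Set.mem_ofPred_eq,
      Set.mem_inter_iff, not_or, not_not, implies_true, and_true]
    constructor
    · rintro ⟨t, -, ⟨ha, hb⟩, hp⟩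
      refine ⟨t, Fin.is_le t, fun i hi hib => hp ?_, hb, ha⟩
      have := t.isLt
      exact ⟨⟨t - 1, by omega⟩, by simp only; omega, ⟨i, by omega⟩,
        Fin.mk_le_mk.2 (by omega), hib⟩
    · rintro ⟨j, hj, hi, hb, ha⟩
      refine ⟨⟨j, by omega⟩, Fin.le_last _, ⟨ha, hb⟩, ?_⟩
      rintro ⟨t, ht, u, hu, hub⟩
      refine hi u ?_ hub
      have : (u : ℕ) ≤ t := hu
      simp only at ht
      omega
  | conj e e' ih ih' =>
    simp only [firstTL, TL.conj, TL.Sat, ih, ih', psUpTo, not_or, not_not, Set.mem_inter_iff]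
  | disj e e' ih ih' => simp only [firstTL, TL.Sat, ih, ih', psUpTo, Set.mem_union]
  | neg e ih => simp only [firstTL, TL.Sat, ih, psUpTo, Set.mem_compl_iff]

/-- `Since` finds the last occurrence of `b`; under position `t` ↦ `n - t` this becomes the first.
-/
theorem sat_revTL (e : FlatExpr E) (n : ℕ) (w : ℕ → Atom E) :
    (revTL e).Sat (fun i : Fin (n + 1) => w i) (Fin.last n) ↔ revPrefix n w ∈ psUpTo n e := by
  induction e with
  | simple a b =>
    simp only [revTL, TL.conj, TL.Sat, TL.sat_ofEvent, psUpTo, Set.mem_ofPred_eq,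
      Set.mem_inter_iff, not_or, not_not]
    constructor
    · rintro ⟨t, -, ⟨ha, hb⟩, hp⟩
      have ht := t.isLt
      have hnt : revPrefix n w (n - t) = w t := by
        rw [revPrefix_of_le w (by omega)]; congr 1; omega
      refine ⟨n - t, by omega, fun i hi => ?_, hnt ▸ hb, hnt ▸ ha⟩
      rw [revPrefix_of_le w (by omega)]
      exact hp ⟨n - i, by omega⟩ (Fin.lt_def.2 (by simp only; omega)) (Fin.le_last _)
    · rintro ⟨j, hj, hi, hb, ha⟩
      rw [revPrefix_of_le w hj] at hb ha
      refine ⟨⟨n - j, by omega⟩, Fin.le_last _, ⟨ha, hb⟩, fun u hu _ => ?_⟩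
      have hu' : n - j < u := hu
      have := u.isLt
      have h := hi (n - u) (by omega)
      rwa [revPrefix_of_le w (by omega), Nat.sub_sub_self (by omega)] at h
  | conj e e' ih ih' =>
    simp only [revTL, TL.conj, TL.Sat, ih, ih', psUpTo, not_or, not_not, Set.mem_inter_iff]
  | disj e e' ih ih' => simp only [revTL, TL.Sat, ih, ih', psUpTo, Set.mem_union]
  | neg e ih => simp only [revTL, TL.Sat, ih, psUpTo, Set.mem_compl_iff]

theorem sat_sparseGiven (e : FlatExpr E) (n : ℕ) (w : ℕ → Atom E) :
    (sparseGiven e).Sat (fun i : Fin (n + 1) => w i) (Fin.last n) ↔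
      revPrefix n w ∈ domUpTo n e := by
  induction e with
  | simple a b =>
    simp only [sparseGiven, TL.once, TL.Sat, TL.sat_ofEvent, domUpTo, Set.mem_ofPred_eq,
      implies_true, and_true, Fin.val_last]
    refine or_congr (by rw [revPrefix_of_le w n.zero_le, Nat.sub_zero]) ⟨fun h i hi hib => ?_, ?_⟩
    · rw [revPrefix_of_le w hi] at hib
      exact h ⟨⟨n - i, by omega⟩, Fin.le_last _, hib⟩
    · rintro h ⟨t, -, ht⟩
      have := t.isLt
      refine h (n - t) (by omega) ?_
      rwa [revPrefix_of_le w (by omega), Nat.sub_sub_self (by omega)]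
  | conj e e' ih ih' => simp only [sparseGiven, TL.Sat, ih, ih', domUpTo, Set.mem_union]
  | disj e e' ih ih' => simp only [sparseGiven, TL.Sat, ih, ih', domUpTo, Set.mem_union]
  | neg e ih => simpa only [sparseGiven, domUpTo] using ih

open Classical in
theorem process_first (e : FlatExpr E) (n : ℕ) (w : ℕ → Atom E) :
    process e.first n w = if w ∈ psUpTo n e then Three.one else Three.zero := by
  simp only [process, first, CondFormula.object, sat_firstTL, TL.Sat, if_true]

open Classical in
theorem process_sparse (e : FlatExpr E) (n : ℕ) (w : ℕ → Atom E) :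
    process e.sparse n w = if revPrefix n w ∈ domUpTo n e then
      if revPrefix n w ∈ psUpTo n e then Three.one else Three.zero else Three.undef := by
  simp only [process, sparse, CondFormula.object, sat_revTL, sat_sparseGiven]

/-! ### Asymptotic probabilities -/

section Asymptotic

variable (μ : Measure (Atom E)) [IsProbabilityMeasure μ]

theorem hasAsympProb_first (e : FlatExpr E) : HasAsympProb μ e.first (e.psProb μ) := by
  have hdef : ∀ n, {w | process e.first n w ≠ Three.undef} = Set.univ := by
    intro n
    ext w
    simp only [process_first, Set.mem_ofPred_eq, Set.mem_univ, iff_true]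
    split_ifs <;> simp
  have hone : ∀ n, {w | process e.first n w = Three.one} = psUpTo n e := by
    intro n
    ext w
    simp [process_first]
  refine ⟨Eventually.of_forall fun n => by simp [hdef], ?_⟩
  simp only [hdef, hone, probReal_univ, div_one]
  exact tendsto_prodProb μ (measurableSet_psUpTo · e) (eventually_mem_psUpTo_iff e)

theorem hasAsympProb_sparse (e : FlatExpr E) : HasAsympProb μ e.sparse (e.psProb μ) := by
  have hdef : ∀ n, (prodProb μ).real {w | process e.sparse n w ≠ Three.undef} =
      (prodProb μ).real (domUpTo n e) := by
    intro n
    have : {w | process e.sparse n w ≠ Three.undef} = revPrefix n ⁻¹' domUpTo n e := by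
      ext w
      simp only [process_sparse, Set.mem_ofPred_eq, Set.mem_preimage]
      split_ifs <;> simp_all
    rw [this, (measurePreserving_revPrefix μ n).measureReal_preimage
      (measurableSet_domUpTo n e).nullMeasurableSet]
  have hone : ∀ n, (prodProb μ).real {w | process e.sparse n w = Three.one} =
      (prodProb μ).real (psUpTo n e ∩ domUpTo n e) := by
    intro n
    have : {w | process e.sparse n w = Three.one} =
        revPrefix n ⁻¹' (psUpTo n e ∩ domUpTo n e) := by
      ext w
      simp only [process_sparse, Set.mem_ofPred_eq, Set.mem_preimage, Set.mem_inter_iff]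
      split_ifs <;> simp_all
    rw [this, (measurePreserving_revPrefix μ n).measureReal_preimage
      ((measurableSet_psUpTo n e).inter (measurableSet_domUpTo n e)).nullMeasurableSet]
  have hlim := tendsto_prodProb μ (measurableSet_domUpTo · e) (eventually_mem_domUpTo_iff e)
  have hlim' := tendsto_prodProb μ
    (fun n => (measurableSet_psUpTo n e).inter (measurableSet_domUpTo n e))
    (B := ps e ∩ dom e) fun w => by
      filter_upwards [eventually_mem_psUpTo_iff e w, eventually_mem_domUpTo_iff e w] with n h h'
        using and_congr h h'
  have h0 := prodProb_dom_ne_zero μ e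
  refine ⟨?_, ?_⟩
  · simp only [hdef]
    exact hlim.eventually_ne h0
  · simp only [hdef, hone]
    -- By independence of `ps e` and `dom e` the limiting quotient cancels to Pr(`ps e`).
    have := hlim'.div hlim h0
    rwa [prodProb_ps_inter_dom, mul_div_cancel_right₀ _ h0] at this

end Asymptotic

end FlatExpr

theorem HasAsympProb.asympProb_eq {E : Type*} [Fintype E] {μ : Measure (Atom E)}
    [IsProbabilityMeasure μ] {c : Word E → Three} {r : ℝ} (h : HasAsympProb μ c r) :
    asympProb μ c = some r := by
  have hex : ∃ r, HasAsympProb μ c r := ⟨r, h⟩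
  rw [asympProb, dif_pos hex]
  exact congrArg some (tendsto_nhds_unique hex.choose_spec.2 h.2)

theorem asympProb_first_eq_sparse {E : Type*} [Fintype E] (μ : Measure (Atom E))
    [IsProbabilityMeasure μ] :
    (fun e : FlatExpr E => asympProb μ e.first) = fun e => asympProb μ e.sparse :=
  funext fun e => (e.hasAsympProb_first μ).asympProb_eq.trans
    (e.hasAsympProb_sparse μ).asympProb_eq.symm

/-! ### The conditional `(∅|a)` -/

section Impossible

variable {E : Type*} [Fintype E]

theorem process_first_simple_empty (a : Event E) (n : ℕ) (w : ℕ → Atom E) :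
    process (FlatExpr.simple ∅ a).first n w = Three.zero := by
  simp [FlatExpr.process_first, FlatExpr.psUpTo]

variable (μ : Measure (Atom E)) [IsProbabilityMeasure μ]

/-- Processes that do not depend on chance are independent. -/
theorem Indep.of_deterministic {c d : Word E → Three} {x₀ y₀ : ℕ → Three}
    (hc : ∀ n w, process c n w = x₀ n) (hd : ∀ n w, process d n w = y₀ n) : Indep μ c d := by
  intro t x y
  simp only [hc, hd]
  by_cases hx : ∀ i : Fin t, x₀ i = x i <;> by_cases hy : ∀ i : Fin t, y₀ i = y i <;>
    simp [hx, hy]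

theorem indep_first_simple_empty (a : Event E) :
    Indep μ (FlatExpr.simple ∅ a).first (FlatExpr.simple ∅ a).first :=
  Indep.of_deterministic μ (process_first_simple_empty a) (process_first_simple_empty a)

theorem not_indep_sparse_simple_empty {a : Event E} (h0 : 0 < μ a) (h1 : μ a < 1) :
    ¬ Indep μ (FlatExpr.simple ∅ a).sparse (FlatExpr.simple ∅ a).sparse := by
  intro h
  -- Two times are needed: on words of length one the conditional is always defined with value 0.
  -- Being undefined at the second time forces `a` to fail there and to have held before.
  have hset : {w : ℕ → Atom E | ∀ i : Fin 2, process (FlatExpr.simple ∅ a).sparse i w =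
      ![Three.zero, Three.undef] i} =
      {w | w 0 ∈ a} ∩ {w | (fun i => w (i + 1)) ∈ {w : ℕ → Atom E | w 0 ∈ aᶜ}} := by
    ext w
    simp only [Fin.forall_fin_two, FlatExpr.process_sparse, FlatExpr.domUpTo, FlatExpr.psUpTo,
      Set.mem_ofPred_eq, Set.mem_inter_iff]
    by_cases hw0 : w 0 ∈ a <;> by_cases hw1 : w 1 ∈ a <;>
      simp [hw0, hw1, revPrefix, Nat.le_one_iff_eq_zero_or_eq_one]
  have hp := h 2 ![Three.zero, Three.undef] ![Three.zero, Three.undef]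
  simp only [and_self] at hp
  rw [hset, prodProb_head_inter_tail μ a (measurableSet_letter aᶜ 0), prodProb_letter] at hp
  have ha : MeasurableSet a := (Set.toFinite a).measurableSet
  have hc0 : μ aᶜ ≠ 0 := by
    rw [ne_eq, prob_compl_eq_zero_iff ha]
    exact h1.ne
  have hne : μ a * μ aᶜ ≠ 0 := mul_ne_zero h0.ne' hc0
  have htop : μ a * μ aᶜ ≠ ⊤ := ENNReal.mul_ne_top (measure_ne_top _ _) (measure_ne_top _ _)
  -- Self-independence makes the probability of this history idempotent; being nonzero it would be
  -- 1, yet it is at most μ(a) < 1.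
  have hone : 1 = μ a * μ aᶜ :=
    (ENNReal.mul_left_inj hne htop).1 ((one_mul _).trans hp)
  have hle : μ a * μ aᶜ ≤ μ a := mul_le_of_le_one_right' prob_le_one
  exact absurd (hone.le.trans hle) (not_le.2 h1)

/-- A nontrivial probability exists as soon as there is a basic event. -/
theorem exists_probability_mem_Ioo (E : Type*) [Fintype E] [Nonempty E] :
    ∃ (μ : Measure (Atom E)) (_ : IsProbabilityMeasure μ) (a : Event E), 0 < μ a ∧ μ a < 1 := by
  let f : Bool → Atom E := fun b _ => b
  let ν : Measure Bool := (PMF.uniformOfFintype Bool).toMeasure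
  have hf : Measurable f := by fun_prop
  -- The two constant atoms differ because `E` is nonempty; each carries half of the fair coin.
  have hpre : f ⁻¹' {f true} = {true} := by
    ext b
    cases b <;> simp [f, funext_iff]
  have hval : ν.map f {f true} = 2⁻¹ := by
    rw [Measure.map_apply hf (measurableSet_singleton _), hpre,
      PMF.toMeasure_apply_singleton _ _ (measurableSet_singleton _)]
    simp
  refine ⟨ν.map f, Measure.isProbabilityMeasure_map hf.aemeasurable, {f true}, ?_, ?_⟩
  · simp [hval]
  · rw [hval]
    exact ENNReal.inv_lt_one.2 ENNReal.one_lt_two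

end Impossible

end CondEvent

theorem mainTheorem4 {E : Type*} [Fintype E] [Nonempty E] :
    -- both interpretations preserve all probabilities
    (∀ (μ : Measure (Atom E)) [IsProbabilityMeasure μ] (e : FlatExpr E),
      HasAsympProb μ e.first (e.psProb μ) ∧ HasAsympProb μ e.sparse (e.psProb μ)) ∧
    -- the conditional `(0|a)` paired with itself, for every event `a` with `0 < Pr(a) < 1`
    (∀ (μ : Measure (Atom E)) [IsProbabilityMeasure μ] (a : Event E), 0 < μ a → μ a < 1 →
      (∀ (n : ℕ) (w : ℕ → Atom E),
        process (FlatExpr.simple ∅ a).first n w = Three.zero) ∧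
      Indep μ (FlatExpr.simple ∅ a).first (FlatExpr.simple ∅ a).first ∧
      ¬ Indep μ (FlatExpr.simple ∅ a).sparse (FlatExpr.simple ∅ a).sparse ∧
      ¬ ∃ S : Set (ProbTerm E × ProbTerm E),
        (Indep μ (FlatExpr.simple ∅ a).first (FlatExpr.simple ∅ a).first ↔
          EqualitiesHold (fun e => asympProb μ e.first) S) ∧
        (Indep μ (FlatExpr.simple ∅ a).sparse (FlatExpr.simple ∅ a).sparse ↔
          EqualitiesHold (fun e => asympProb μ e.sparse) S)) ∧
    -- such a probability space and such expressions exist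
    (∃ (μ : Measure (Atom E)) (_ : IsProbabilityMeasure μ) (e₁ e₂ : FlatExpr E),
      Indep μ e₁.first e₂.first ∧ ¬ Indep μ e₁.sparse e₂.sparse) ∧
    -- no equalities of asymptotic probabilities characterize independence
    ¬ ∃ S : FlatExpr E → FlatExpr E → Set (ProbTerm E × ProbTerm E),
      CharacterizesIndep FlatExpr.first S ∧ CharacterizesIndep FlatExpr.sparse S := by
  refine ⟨fun μ _ e => ⟨e.hasAsympProb_first μ, e.hasAsympProb_sparse μ⟩, ?_, ?_, ?_⟩
  · intro μ _ a h0 h1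
    have hF := indep_first_simple_empty μ a
    have hR := not_indep_sparse_simple_empty μ h0 h1
    refine ⟨process_first_simple_empty a, hF, hR, ?_⟩
    rintro ⟨S, hS, hS'⟩
    -- Both equivalences now test the same equalities under one assignment, so independence would
    -- transfer from `first` to `sparse`.
    rw [← asympProb_first_eq_sparse] at hS'
    exact hR (hS'.2 (hS.1 hF))
  · obtain ⟨μ, hμ, a, h0, h1⟩ := exists_probability_mem_Ioo E
    exact ⟨μ, hμ, .simple ∅ a, .simple ∅ a, indep_first_simple_empty μ a,
      not_indep_sparse_simple_empty μ h0 h1⟩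
  · rintro ⟨S, hS, hS'⟩
    obtain ⟨μ, hμ, a, h0, h1⟩ := exists_probability_mem_Ioo E
    have h := (hS μ (.simple ∅ a) (.simple ∅ a)).1 (indep_first_simple_empty μ a)
    rw [asympProb_first_eq_sparse] at h
    exact not_indep_sparse_simple_empty μ h0 h1 ((hS' μ _ _).2 h)
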